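/- Let $d\ge 2$ be an integer, let $\mathbb S^d=\{x\in\mathbb R^{d+1}:\|x\|=1\}$ be the unit sphere with its surface measure $\mathrm dy$, and let $\theta(x,y)=\arccos\langle x,y\rangle\in[0,\pi]$ be the great-circle distance on $\mathbb S^d$. A kernel $f:\mathbb S^d\times\mathbb S^d\to\mathbb C$ is called positive definite if $\sum_{i,j=1}^n f(x_i,x_j)c_i\overline{c_j}\ge 0$ for all $n\in\mathbb N$, $x_1,\dots,x_n\in\mathbb S^d$ and $c_1,\dots,c_n\in\mathbb C$. For $0<c\le\pi$ let $\Psi^d_c$ be the set of all continuous functions $\psi:[0,\pi]\to\mathbb R$ such that $\psi(0)=1$, the kernel $(x,y)\mapsto\psi(\theta(x,y))$ is positive definite on $\mathbb S^d$, and $\psi(t)=0$ for all $t\in[0,\pi]$ with $t\ge c$. Define the spherical Turán constant $$\mathcal T_{\mathbb S^d}(c)=\sup_{\psi\in\Psi^d_c}\int_{\mathbb S^d}\psi(\theta(x,y))\,\mathrm dy ,$$ where $x\in\mathbb S^d$ is an arbitrary point (the value of the supremum is finite and does not depend on $x$). Then for every $0<c\le\pi$ there exists an extremal function for $\mathcal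 T_{\mathbb S^d}(c)$: there is $\psi\in\Psi^d_c$ such that $$\int_{\mathbb S^d}\psi(\theta(x,y))\,\mathrm dy=\mathcal T_{\mathbb S^d}(c)\qquad\text{for every }x\in\mathbb S^d .$$ -/

import Mathlib

open MeasureTheory

open scoped ComplexOrder ComplexConjugate

noncomputable section

/-- A kernel `f : X × X → ℂ` is positive definite if all the sums
`∑ᵢ ∑ⱼ f(xᵢ, xⱼ) cᵢ c̄ⱼ` are nonnegative (in particular real). -/
def IsPositiveDefiniteKernel {X : Type*} (f : X → X → ℂ) : Prop :=
  ∀ (n : ℕ) (x : Fin n → X) (c : Fin n → ℂ),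
    0 ≤ ∑ i, ∑ j, f (x i) (x j) * c i * conj (c j)

/-- The unit sphere `𝕊ᵈ` of the Euclidean space `ℝᵈ⁺¹`. -/
abbrev UnitSphere (d : ℕ) : Type :=
  Metric.sphere (0 : EuclideanSpace ℝ (Fin (d + 1))) 1

/-- The surface measure on `𝕊ᵈ` (not normalised). -/
def surfaceMeasure (d : ℕ) : Measure (UnitSphere d) :=
  (volume : Measure (EuclideanSpace ℝ (Fin (d + 1)))).toSphere

/-- The great-circle distance `θ(x, y) = arccos ⟨x, y⟩`, as a point of `[0, π]`. -/
def greatCircleDist {d : ℕ} (x y : UnitSphere d) : Set.Icc (0 : ℝ) Real.pi :=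
  ⟨Real.arccos (inner ℝ (x : EuclideanSpace ℝ (Fin (d + 1))) y),
    Real.arccos_nonneg _, Real.arccos_le_pi _⟩

/-- The isotropic kernel `ψ ∘ θ` on `𝕊ᵈ`. -/
def isotropicKernel (d : ℕ) (ψ : Set.Icc (0 : ℝ) Real.pi → ℝ) (x y : UnitSphere d) : ℝ :=
  ψ (greatCircleDist x y)

/-- The class `Ψᵈ` of continuous `ψ : [0, π] → ℝ` with `ψ(0) = 1` whose associated isotropic
kernel on `𝕊ᵈ` is positive definite. -/
def isotropicClass (d : ℕ) : Set (Set.Icc (0 : ℝ) Real.pi → ℝ) :=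
  {ψ | Continuous ψ ∧ ψ ⟨0, le_rfl, Real.pi_pos.le⟩ = 1 ∧
    IsPositiveDefiniteKernel (fun x y : UnitSphere d => (isotropicKernel d ψ x y : ℂ))}

/-- The class `Ψᵈ_c` of those `ψ ∈ Ψᵈ` with `ψ(t) = 0` for all `t ∈ [0, π]`, `t ≥ c`. -/
def capClass (d : ℕ) (c : ℝ) : Set (Set.Icc (0 : ℝ) Real.pi → ℝ) :=
  {ψ | ψ ∈ isotropicClass d ∧ ∀ t : Set.Icc (0 : ℝ) Real.pi, c ≤ (t : ℝ) → ψ t = 0}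

/-- The integral `∫ ψ(θ(x, y)) dy` over `𝕊ᵈ`. -/
def capIntegral (d : ℕ) (x : UnitSphere d) (ψ : Set.Icc (0 : ℝ) Real.pi → ℝ) : ℝ :=
  ∫ y, isotropicKernel d ψ x y ∂(surfaceMeasure d)

/-- The north pole `(0, …, 0, 1)` of `𝕊ᵈ`. -/
def northPole (d : ℕ) : UnitSphere d :=
  ⟨EuclideanSpace.single (Fin.last d) 1, by simp⟩

/-- The spherical Turán constant: the supremum of `∫ ψ(θ(x, y)) dy` over `ψ ∈ Ψᵈ_c`, with the
north pole as the (arbitrary) base point `x`. -/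
def sphericalTuranConstant (d : ℕ) (c : ℝ) : ℝ :=
  sSup (capIntegral d (northPole d) '' capClass d c)

end

/-! For `c < π` the extremal function is a weak limit. Write `ψ * f (x) = ∫ ψ(θ(x, y)) f(y) dy` and
let `ψ_k` be a maximising sequence. For fixed continuous `f` the functions `ψ_k * f` are uniformly
bounded and equicontinuous, so along an ultrafilter they converge uniformly to some `L x f`. This
limit need not be given by a continuous kernel a priori. However, Cauchy–Schwarz together with
`ψ_k(0) = 1` gives `(ψ_k * f (x))² ≤ ∫ (ψ_k * f) f`, which survives in the limit. By Riesz, `L x` is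
then represented by a vector `w x` of norm at most 1 in the Hilbert space of the limiting quadratic
form. The kernel `⟨w x, w y⟩` is rotation invariant and separately continuous, hence of the form
`φ(θ(x, y))` with `φ` continuous, and `φ * f = L f` (`exists_isotropic_of_functional`,
`exists_weak_limit`).

The limit has the right integral and support, but possibly `φ(0) < 1`. As `φ(0) > 0`, dividing by
`φ(0)` restores the normalisation and can only increase the integral (`exists_extremal_of_lt_pi`).

For `c = π` the support condition concerns the single point `π` and is invisible to weak limits.
There `(1 + cos t) / 2` is extremal, by Cauchy–Schwarz applied to a pair of antipodal points
(`two_mul_capIntegral_le`, `exists_extremal_pi`). -/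

/-! ### Hilbert space tools. -/

/-- A positive semidefinite symmetric bilinear form is realised by a linear map with dense range
into a Hilbert space. -/
theorem exists_hilbert_of_posSemidef {V : Type} [AddCommGroup V] [Module ℝ V]
    (B : V →ₗ[ℝ] V →ₗ[ℝ] ℝ) (hsymm : ∀ f g, B f g = B g f) (hpos : ∀ f, 0 ≤ B f f) :
    ∃ (H : Type) (_ : NormedAddCommGroup H) (_ : InnerProductSpace ℝ H) (_ : CompleteSpace H)
      (ι : V →ₗ[ℝ] H), (∀ f g, inner ℝ (ι f) (ι g) = B f g) ∧ DenseRange ι := by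
  let core : PreInnerProductSpace.Core ℝ V :=
    { inner := fun f g => B f g
      conj_inner_symm := fun f g => hsymm g f
      re_inner_nonneg := fun f => hpos f
      add_left := fun f g h => by simp
      smul_left := fun f g r => by simp }
  let _ : SeminormedAddCommGroup V := InnerProductSpace.Core.toSeminormedAddCommGroup (𝕜 := ℝ)
  let _ : InnerProductSpace ℝ V := InnerProductSpace.ofCore core
  -- The completion is Hausdorff, so it also kills the null vectors of `B`; no definiteness is
  -- needed.
  refine ⟨UniformSpace.Completion V, inferInstance, inferInstance, inferInstance,
    (UniformSpace.Completion.toComplL (𝕜 := ℝ) (E := V)).toLinearMap, fun f g => ?_, ?_⟩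
  · exact UniformSpace.Completion.inner_coe f g
  · exact UniformSpace.Completion.denseRange_coe

/-- A linear functional bounded by the norm of a dense linear map is an inner product. -/
theorem exists_inner_eq_of_sq_le {V H : Type} [AddCommGroup V] [Module ℝ V]
    [NormedAddCommGroup H] [InnerProductSpace ℝ H] [CompleteSpace H] (ι : V →ₗ[ℝ] H)
    (hι : DenseRange ι) (L : V →ₗ[ℝ] ℝ) (hL : ∀ f, L f ^ 2 ≤ inner ℝ (ι f) (ι f)) :
    ∃ w : H, ‖w‖ ≤ 1 ∧ ∀ f, inner ℝ w (ι f) = L f := by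
  have hb : ∀ f, ‖L f‖ ≤ 1 * ‖ι f‖ := fun f => by
    have := hL f
    rw [real_inner_self_eq_norm_sq] at this
    rw [one_mul, Real.norm_eq_abs]
    exact abs_le_of_sq_le_sq this (norm_nonneg _)
  refine ⟨(InnerProductSpace.toDual ℝ H).symm (L.extendOfNorm ι), ?_, fun f => ?_⟩
  · rw [LinearIsometryEquiv.norm_map]
    exact LinearMap.opNorm_extendOfNorm_le hι zero_le_one hb
  · rw [InnerProductSpace.toDual_symm_apply, LinearMap.extendOfNorm_eq hι ⟨1, hb⟩]

/-- If every pairing of `w` with a dense set is matched by a pairing of `w'` with a vector of the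
same norm, then `‖w‖ ≤ ‖w'‖`. -/
theorem norm_le_of_inner_match {V H : Type} [NormedAddCommGroup H] [InnerProductSpace ℝ H]
    (ι : V → H) (hι : DenseRange ι) (w w' : H)
    (h : ∀ f, ∃ f', inner ℝ w (ι f) = inner ℝ w' (ι f') ∧ ‖ι f'‖ = ‖ι f‖) : ‖w‖ ≤ ‖w'‖ := by
  have key : ∀ v : H, inner ℝ w v ≤ ‖w'‖ * ‖v‖ := fun v => by
    refine hι.induction_on v (isClosed_le (by fun_prop) (by fun_prop)) fun f => ?_
    obtain ⟨f', h1, h2⟩ := h f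
    rw [h1, ← h2]
    exact real_inner_le_norm _ _
  have := key w
  rw [real_inner_self_eq_norm_sq] at this
  rcases (norm_nonneg w).eq_or_lt with h0 | h0
  · rw [← h0]; exact norm_nonneg _
  · nlinarith

/-- Weak continuity of a bounded family of vectors may be tested on a dense set. -/
theorem continuous_inner_of_denseRange {V X H : Type} [TopologicalSpace X]
    [NormedAddCommGroup H] [InnerProductSpace ℝ H] (ι : V → H) (hι : DenseRange ι) (w : X → H)
    (hw : ∀ x, ‖w x‖ ≤ 1) (hc : ∀ f, Continuous fun x => inner ℝ (w x) (ι f)) (v : H) :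
    Continuous fun x => inner ℝ (w x) v := by
  refine continuous_of_uniform_approx_of_continuous fun s hs => ?_
  obtain ⟨ε, hε, hεs⟩ := Metric.mem_uniformity_dist.1 hs
  obtain ⟨f, hf⟩ := hι.exists_dist_lt v hε
  refine ⟨_, hc f, fun x => hεs ?_⟩
  rw [Real.dist_eq, ← inner_sub_right]
  calc |inner ℝ (w x) (v - ι f)| ≤ ‖w x‖ * ‖v - ι f‖ := abs_real_inner_le_norm _ _
    _ ≤ 1 * ‖v - ι f‖ := by gcongr; exact hw x
    _ < ε := by rwa [one_mul, ← dist_eq_norm]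

/-! ### Positive definite kernels and feature maps. -/

/-- A symmetric real kernel is positive definite as soon as its real quadratic forms are
nonnegative. -/
theorem isPositiveDefiniteKernel_of_real {X : Type*} (K : X → X → ℝ)
    (hsymm : ∀ x y, K x y = K y x)
    (hpos : ∀ (n : ℕ) (x : Fin n → X) (a : Fin n → ℝ), 0 ≤ ∑ i, ∑ j, a i * a j * K (x i) (x j)) :
    IsPositiveDefiniteKernel fun x y => (K x y : ℂ) := by
  intro n x c
  rw [Complex.nonneg_iff]
  constructor
  · have h : (∑ i, ∑ j, (K (x i) (x j) : ℂ) * c i * conj (c j)).re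
        = ∑ i, ∑ j, (c i).re * (c j).re * K (x i) (x j)
          + ∑ i, ∑ j, (c i).im * (c j).im * K (x i) (x j) := by
      rw [Complex.re_sum, ← Finset.sum_add_distrib]
      refine Finset.sum_congr rfl fun i _ => ?_
      rw [Complex.re_sum, ← Finset.sum_add_distrib]
      refine Finset.sum_congr rfl fun j _ => ?_
      simp
      ring
    rw [h]
    exact add_nonneg (hpos n x fun i => (c i).re) (hpos n x fun i => (c i).im)
  · have h : (∑ i, ∑ j, (K (x i) (x j) : ℂ) * c i * conj (c j)).im
        = ∑ i, ∑ j, K (x i) (x j) * ((c i).im * (c j).re)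
          - ∑ i, ∑ j, K (x i) (x j) * ((c j).im * (c i).re) := by
      rw [Complex.im_sum, ← Finset.sum_sub_distrib]
      refine Finset.sum_congr rfl fun i _ => ?_
      rw [Complex.im_sum, ← Finset.sum_sub_distrib]
      refine Finset.sum_congr rfl fun j _ => ?_
      simp
      ring
    rw [h, eq_comm, sub_eq_zero, Finset.sum_comm]
    exact Finset.sum_congr rfl fun i _ => Finset.sum_congr rfl fun j _ => by rw [hsymm]

theorem isPositiveDefiniteKernel_inner {X H : Type*} [NormedAddCommGroup H]
    [InnerProductSpace ℝ H] (w : X → H) :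
    IsPositiveDefiniteKernel fun x y => ((inner ℝ (w x) (w y) : ℝ) : ℂ) := by
  refine isPositiveDefiniteKernel_of_real _ (fun x y => real_inner_comm _ _) fun n x a => ?_
  have h : ∑ i, ∑ j, a i * a j * inner ℝ (w (x i)) (w (x j))
      = inner ℝ (∑ i, a i • w (x i)) (∑ i, a i • w (x i)) := by
    rw [sum_inner]
    refine Finset.sum_congr rfl fun i _ => ?_
    rw [inner_sum]
    refine Finset.sum_congr rfl fun j _ => ?_
    rw [real_inner_smul_left, real_inner_smul_right]
    ring
  rw [h]
  exact real_inner_self_nonneg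

/-- The real quadratic forms of a positive definite kernel are nonnegative. -/
theorem IsPositiveDefiniteKernel.real_nonneg {X : Type*} {K : X → X → ℝ}
    (h : IsPositiveDefiniteKernel fun x y => (K x y : ℂ)) (n : ℕ) (x : Fin n → X) (a : Fin n → ℝ) :
    0 ≤ ∑ i, ∑ j, a i * a j * K (x i) (x j) := by
  have := h n x fun i => a i
  simp only [Complex.conj_ofReal] at this
  have h2 : 0 ≤ (((∑ i, ∑ j, a i * a j * K (x i) (x j) : ℝ)) : ℂ) := by
    push_cast
    refine this.trans_eq (Finset.sum_congr rfl fun i _ => Finset.sum_congr rfl fun j _ => ?_)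
    ring
  exact_mod_cast h2

/-- Feature map of a symmetric real positive definite kernel. -/
theorem IsPositiveDefiniteKernel.exists_feature {X : Type} {K : X → X → ℝ}
    (h : IsPositiveDefiniteKernel fun x y => (K x y : ℂ)) (hsymm : ∀ x y, K x y = K y x) :
    ∃ (H : Type) (_ : NormedAddCommGroup H) (_ : InnerProductSpace ℝ H) (_ : CompleteSpace H)
      (u : X → H), ∀ x y, inner ℝ (u x) (u y) = K x y := by
  let B : (X →₀ ℝ) →ₗ[ℝ] (X →₀ ℝ) →ₗ[ℝ] ℝ :=
    Finsupp.linearCombination ℝ fun x => Finsupp.linearCombination ℝ (K x)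
  have hB : ∀ f g, B f g = ∑ x ∈ f.support, ∑ y ∈ g.support, f x * g y * K x y := fun f g => by
    simp only [B, Finsupp.linearCombination_apply, Finsupp.sum, LinearMap.sum_apply,
      LinearMap.smul_apply, smul_eq_mul, Finset.mul_sum, mul_assoc]
  obtain ⟨H, _, _, _, ι, hι, -⟩ := exists_hilbert_of_posSemidef B
    (fun f g => by
      rw [hB, hB, Finset.sum_comm]
      exact Finset.sum_congr rfl fun x _ => Finset.sum_congr rfl fun y _ => by
        rw [hsymm, mul_comm (f y)])
    (fun f => by
      rw [hB]
      refine (h.real_nonneg _ (fun i => (f.support.equivFin.symm i : X))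
        fun i => f (f.support.equivFin.symm i)).trans_eq ?_
      have hs : ∀ F : X → ℝ, ∑ i, F (f.support.equivFin.symm i) = ∑ x ∈ f.support, F x :=
        fun F => by
          rw [← Finset.sum_coe_sort f.support, ← Equiv.sum_comp f.support.equivFin.symm]
      simp_rw [← hs])
  refine ⟨H, inferInstance, inferInstance, inferInstance, fun x => ι (Finsupp.single x 1),
    fun x y => ?_⟩
  rw [hι]
  simp [B]

/-! ### Isometries and geometry of the sphere. -/

/-- The action of a linear isometry on the unit sphere. -/
noncomputable def sphereIsometry {d : ℕ}
    (g : EuclideanSpace ℝ (Fin (d + 1)) ≃ₗᵢ[ℝ] EuclideanSpace ℝ (Fin (d + 1))) :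
    UnitSphere d ≃ₜ UnitSphere d where
  toFun x := ⟨g x, by simp⟩
  invFun x := ⟨g.symm x, by simp⟩
  left_inv x := by simp
  right_inv x := by simp
  continuous_toFun := by fun_prop
  continuous_invFun := by fun_prop

section
variable {d : ℕ}

theorem sphereIsometry_coe
    (g : EuclideanSpace ℝ (Fin (d + 1)) ≃ₗᵢ[ℝ] EuclideanSpace ℝ (Fin (d + 1)))
    (x : UnitSphere d) : (sphereIsometry g x : EuclideanSpace ℝ (Fin (d + 1))) = g x := rfl

theorem greatCircleDist_sphereIsometry
    (g : EuclideanSpace ℝ (Fin (d + 1)) ≃ₗᵢ[ℝ] EuclideanSpace ℝ (Fin (d + 1)))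
    (x y : UnitSphere d) :
    greatCircleDist (sphereIsometry g x) (sphereIsometry g y) = greatCircleDist x y := by
  simp [greatCircleDist, sphereIsometry_coe]

theorem greatCircleDist_comm (x y : UnitSphere d) : greatCircleDist x y = greatCircleDist y x := by
  simp [greatCircleDist, real_inner_comm]

theorem inner_self_sphere (x : UnitSphere d) :
    inner ℝ (x : EuclideanSpace ℝ (Fin (d + 1))) x = 1 := by
  rw [real_inner_self_eq_norm_sq, norm_eq_of_mem_sphere]
  norm_num

theorem greatCircleDist_self (x : UnitSphere d) :
    greatCircleDist x x = ⟨0, le_rfl, Real.pi_pos.le⟩ := by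
  apply Subtype.ext
  simp only [greatCircleDist]
  rw [inner_self_sphere, Real.arccos_one]

theorem greatCircleDist_neg_self (x : UnitSphere d) :
    greatCircleDist x (-x) = ⟨Real.pi, Real.pi_pos.le, le_rfl⟩ := by
  apply Subtype.ext
  simp only [greatCircleDist]
  rw [coe_neg_sphere, inner_neg_right, inner_self_sphere, Real.arccos_neg_one]

theorem cos_greatCircleDist (x y : UnitSphere d) :
    Real.cos (greatCircleDist x y) = inner ℝ (x : EuclideanSpace ℝ (Fin (d + 1))) y := by
  have h := abs_real_inner_le_norm (x : EuclideanSpace ℝ (Fin (d + 1))) y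
  rw [norm_eq_of_mem_sphere, norm_eq_of_mem_sphere, one_mul, abs_le] at h
  exact Real.cos_arccos h.1 h.2

theorem greatCircleDist_triangle (x y z : UnitSphere d) :
    (greatCircleDist x z : ℝ) ≤ greatCircleDist x y + greatCircleDist y z := by
  have h : ∀ a b : UnitSphere d, (greatCircleDist a b : ℝ)
      = InnerProductGeometry.angle (a : EuclideanSpace ℝ (Fin (d + 1))) b := fun a b => by
    simp [greatCircleDist, InnerProductGeometry.angle]
  rw [h, h, h]
  exact InnerProductGeometry.angle_le_angle_add_angle _ _ _

theorem continuous_greatCircleDist :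
    Continuous fun p : UnitSphere d × UnitSphere d => greatCircleDist p.1 p.2 := by
  refine Continuous.subtype_mk (Real.continuous_arccos.comp ?_) _
  fun_prop

/-- The surface measure of a set is a multiple of the Lebesgue measure of the cone over it, and a
linear isometry carries cones to cones while preserving Lebesgue measure. -/
theorem measurePreserving_sphereIsometry
    (g : EuclideanSpace ℝ (Fin (d + 1)) ≃ₗᵢ[ℝ] EuclideanSpace ℝ (Fin (d + 1))) :
    MeasurePreserving (sphereIsometry g) (surfaceMeasure d) (surfaceMeasure d) := by
  refine ⟨(sphereIsometry g).continuous.measurable, Measure.ext fun s hs => ?_⟩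
  rw [Measure.map_apply (sphereIsometry g).continuous.measurable hs, surfaceMeasure,
    Measure.toSphere_apply' _ hs,
    Measure.toSphere_apply' _ ((sphereIsometry g).continuous.measurable hs)]
  congr 1
  symm
  rw [← g.measurePreserving.measure_preimage_emb g.toHomeomorph.measurableEmbedding]
  refine congrArg _ (Set.ext fun v => Iff.symm ?_)
  simp only [Set.mem_smul, Set.mem_image, Set.mem_preimage]
  constructor
  · rintro ⟨r, hr, -, ⟨x, hx, rfl⟩, rfl⟩
    exact ⟨r, hr, _, ⟨_, hx, rfl⟩, by simp [sphereIsometry_coe]⟩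
  · rintro ⟨r, hr, -, ⟨x, hx, rfl⟩, h⟩
    refine ⟨r, hr, _, ⟨(sphereIsometry g).symm x, by simpa using hx, rfl⟩, ?_⟩
    apply g.injective
    rw [map_smul, ← sphereIsometry_coe, Homeomorph.apply_symm_apply]
    exact h

theorem integral_comp_sphereIsometry
    (g : EuclideanSpace ℝ (Fin (d + 1)) ≃ₗᵢ[ℝ] EuclideanSpace ℝ (Fin (d + 1)))
    (f : UnitSphere d → ℝ) :
    ∫ y, f (sphereIsometry g y) ∂surfaceMeasure d = ∫ y, f y ∂surfaceMeasure d :=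
  (measurePreserving_sphereIsometry g).integral_comp (sphereIsometry g).measurableEmbedding f

/-- The sphere is two-point homogeneous. -/
theorem exists_sphereIsometry {x y x' y' : UnitSphere d}
    (h : greatCircleDist x y = greatCircleDist x' y') :
    ∃ g, sphereIsometry g x = x' ∧ sphereIsometry g y = y' := by
  have h1 : inner ℝ (x : EuclideanSpace ℝ (Fin (d + 1))) y = inner ℝ (x' : EuclideanSpace ℝ (Fin (d + 1))) y' := by
    rw [← cos_greatCircleDist, ← cos_greatCircleDist, h]
  let r := (ℝ ∙ ((x : EuclideanSpace ℝ (Fin (d + 1))) - x'))ᗮ.reflection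
  have hr : r x = x' := Submodule.reflection_sub (by simp)
  -- The second reflection leaves `x'` in place: `⟨x', r y⟩ = ⟨x, y⟩ = ⟨x', y'⟩` puts `x'` in its
  -- mirror hyperplane.
  let s := (ℝ ∙ (r y - (y' : EuclideanSpace ℝ (Fin (d + 1)))))ᗮ.reflection
  have hs : s (r y) = y' := Submodule.reflection_sub (by simp)
  refine ⟨r.trans s, Subtype.ext ?_, Subtype.ext hs⟩
  change s (r x) = x'
  rw [hr]
  apply Submodule.reflection_mem_subspace_eq_self
  rw [Submodule.mem_orthogonal_singleton_iff_inner_left, inner_sub_right, ← h1, ← hr,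
    LinearIsometryEquiv.inner_map_map, sub_self]

theorem reflection_span_singleton_apply {F : Type*} [NormedAddCommGroup F] [InnerProductSpace ℝ F]
    (u v : F) : (ℝ ∙ u).reflection v = (2 * (inner ℝ u v / ‖u‖ ^ 2)) • u - v := by
  rw [Submodule.reflection_singleton_apply, mul_smul, ← Nat.cast_smul_eq_nsmul ℝ]
  norm_num

theorem continuousAt_reflection_span_singleton {F : Type*} [NormedAddCommGroup F]
    [InnerProductSpace ℝ F] {u : F} (hu : u ≠ 0) (v : F) :
    ContinuousAt (fun u => (ℝ ∙ u).reflection v) u := by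
  simp only [reflection_span_singleton_apply]
  have : ‖u‖ ^ 2 ≠ 0 := pow_ne_zero 2 (norm_ne_zero_iff.2 hu)
  fun_prop (disch := assumption)

/-- Every point close to `x` is the image of `x` under an isometry close to the identity. -/
theorem exists_sphereIsometry_tendsto (x : UnitSphere d) :
    ∃ G : UnitSphere d →
        (EuclideanSpace ℝ (Fin (d + 1)) ≃ₗᵢ[ℝ] EuclideanSpace ℝ (Fin (d + 1))),
      (∀ᶠ z in nhds x, sphereIsometry (G z) x = z) ∧
        ∀ y, Filter.Tendsto (fun z => sphereIsometry (G z) y) (nhds x) (nhds y) := by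
  have hx : ‖(x : EuclideanSpace ℝ (Fin (d + 1)))‖ = 1 := norm_eq_of_mem_sphere x
  have hne : ‖(x : EuclideanSpace ℝ (Fin (d + 1))) + x‖ ≠ 0 := by
    rw [← two_smul ℝ, norm_smul, hx]; norm_num
  have hcont : ContinuousAt
      (fun z : UnitSphere d => ‖(x : EuclideanSpace ℝ (Fin (d + 1))) + z‖) x := by fun_prop
  -- The reflection in the line of `x` fixes `x`; the one in the line of `x + z` then exchanges `x`
  -- and `z` when `z ≠ -x`. At `z = x` both are the same involution, so the product is the identity.
  refine ⟨fun z => (ℝ ∙ (x : EuclideanSpace ℝ (Fin (d + 1)))).reflection.trans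
    (ℝ ∙ ((x : EuclideanSpace ℝ (Fin (d + 1))) + z)).reflection, ?_, fun y => ?_⟩
  · filter_upwards [hcont.eventually_ne hne] with z hz
    apply Subtype.ext
    rw [sphereIsometry_coe, LinearIsometryEquiv.trans_apply,
      Submodule.reflection_mem_subspace_eq_self (Submodule.mem_span_singleton_self _),
      reflection_span_singleton_apply]
    have h2 : ‖(x : EuclideanSpace ℝ (Fin (d + 1))) + z‖ ^ 2
        = 2 * inner ℝ ((x : EuclideanSpace ℝ (Fin (d + 1))) + z) (x : EuclideanSpace ℝ (Fin (d + 1))) := by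
      rw [norm_add_sq_real, hx, norm_eq_of_mem_sphere z, inner_add_left, inner_self_sphere,
        real_inner_comm]
      ring
    have h3 : 2 * (inner ℝ ((x : EuclideanSpace ℝ (Fin (d + 1))) + z) (x : EuclideanSpace ℝ (Fin (d + 1)))
        / ‖(x : EuclideanSpace ℝ (Fin (d + 1))) + z‖ ^ 2) = 1 := by
      have : ‖(x : EuclideanSpace ℝ (Fin (d + 1))) + z‖ ^ 2 ≠ 0 := pow_ne_zero 2 hz
      rw [← mul_div_assoc, div_eq_iff this, one_mul, h2]
    rw [h3, one_smul, add_sub_cancel_left]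
  · rw [tendsto_subtype_rng]
    simp only [sphereIsometry_coe, LinearIsometryEquiv.trans_apply]
    set v := (ℝ ∙ (x : EuclideanSpace ℝ (Fin (d + 1)))).reflection y with hv
    have hspan : (ℝ ∙ ((x : EuclideanSpace ℝ (Fin (d + 1))) + x)).reflection v = y := by
      have ha : inner ℝ (x : EuclideanSpace ℝ (Fin (d + 1))) v = inner ℝ (x : EuclideanSpace ℝ (Fin (d + 1))) y := by
        rw [hv, ← LinearIsometryEquiv.inner_map_map (ℝ ∙ (x : EuclideanSpace ℝ (Fin (d + 1)))).reflection,
          Submodule.reflection_reflection,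
          Submodule.reflection_mem_subspace_eq_self (Submodule.mem_span_singleton_self _)]
      have h4 : ‖(x : EuclideanSpace ℝ (Fin (d + 1))) + x‖ ^ 2 = 4 := by
        rw [← two_smul ℝ, norm_smul, hx]; norm_num
      rw [reflection_span_singleton_apply, h4, inner_add_left, ha, hv,
        reflection_span_singleton_apply, hx]
      module
    have hc : Filter.Tendsto (fun z : UnitSphere d => (x : EuclideanSpace ℝ (Fin (d + 1))) + z)
        (nhds x) (nhds (x + x)) :=
      Continuous.tendsto (f := fun z : UnitSphere d => (x : EuclideanSpace ℝ (Fin (d + 1))) + z)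
        (by fun_prop) x
    have := (continuousAt_reflection_span_singleton (norm_ne_zero_iff.1 hne) v).tendsto.comp hc
    rwa [hspan] at this

/-- A half great circle is a continuous section of the distance to a point. It turns statements
about isotropic kernels into statements about functions on `[0, π]`. -/
theorem exists_path_greatCircleDist (hd : 1 ≤ d) : ∃ (x : UnitSphere d)
    (γ : Set.Icc (0 : ℝ) Real.pi → UnitSphere d), Continuous γ ∧
      ∀ t, greatCircleDist x (γ t) = t := by
  let e : EuclideanSpace ℝ (Fin (d + 1)) := EuclideanSpace.single 0 1
  let n : EuclideanSpace ℝ (Fin (d + 1)) := EuclideanSpace.single (Fin.last d) 1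
  have hne : (0 : Fin (d + 1)) ≠ Fin.last d := by
    intro h
    have := congrArg Fin.val h
    simp at this
    omega
  have h1 : inner ℝ n e = 0 := by simp [e, n, EuclideanSpace.inner_single_left, hne]
  have h2 : ‖n‖ = 1 := by simp [n]
  have h3 : ‖e‖ = 1 := by simp [e]
  have hmem : ∀ t : ℝ, ‖Real.cos t • n + Real.sin t • e‖ = 1 := fun t => by
    rw [← sq_eq_sq₀ (norm_nonneg _) zero_le_one, norm_add_sq_real, norm_smul, norm_smul,
      inner_smul_left, inner_smul_right, h1, h2, h3]
    simp
  refine ⟨⟨n, by simpa using h2⟩, fun t => ⟨Real.cos t • n + Real.sin t • e, by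
    simpa using hmem t⟩, by fun_prop, fun t => Subtype.ext ?_⟩
  simp only [greatCircleDist]
  rw [inner_add_right, inner_smul_right, inner_smul_right, h1, real_inner_self_eq_norm_sq, h2]
  simpa using Real.arccos_cos t.2.1 t.2.2

/-- A continuous kernel invariant under all isometries is isotropic. -/
theorem exists_isotropic_of_invariant (hd : 1 ≤ d) (F : UnitSphere d → UnitSphere d → ℝ)
    (hinv : ∀ g x y, F (sphereIsometry g x) (sphereIsometry g y) = F x y)
    (hcont : ∀ x, Continuous (F x)) :
    ∃ ψ : Set.Icc (0 : ℝ) Real.pi → ℝ, Continuous ψ ∧ ∀ x y, ψ (greatCircleDist x y) = F x y := by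
  obtain ⟨x₀, γ, hγ, h⟩ := exists_path_greatCircleDist hd
  refine ⟨fun t => F x₀ (γ t), (hcont x₀).comp hγ, fun x y => ?_⟩
  obtain ⟨g, h1, h2⟩ := exists_sphereIsometry (h (greatCircleDist x y))
  change F x₀ (γ _) = _
  rw [← hinv g, h1, h2]

end

/-! ### Spherical convolution and equicontinuity. -/

instance (d : ℕ) : IsFiniteMeasure (surfaceMeasure d) := by
  unfold surfaceMeasure; infer_instance

instance (d : ℕ) : (surfaceMeasure d).IsOpenPosMeasure := by
  unfold surfaceMeasure; infer_instance

/-- The spherical convolution `∫ ψ(θ(x, y)) f(y) dy`. -/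
noncomputable def sphericalConv {d : ℕ} (ψ : Set.Icc (0 : ℝ) Real.pi → ℝ) (x : UnitSphere d)
    (f : UnitSphere d → ℝ) : ℝ :=
  ∫ y, ψ (greatCircleDist x y) * f y ∂surfaceMeasure d

section
variable {d : ℕ}

theorem Continuous.integrable_surfaceMeasure {E : Type*} [NormedAddCommGroup E]
    {f : UnitSphere d → E} (hf : Continuous f) : Integrable f (surfaceMeasure d) :=
  hf.integrable_of_hasCompactSupport (HasCompactSupport.of_compactSpace f)

theorem continuous_kernel {ψ : Set.Icc (0 : ℝ) Real.pi → ℝ} (hψ : Continuous ψ)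
    (x : UnitSphere d) : Continuous fun y => ψ (greatCircleDist x y) :=
  Continuous.comp (g := ψ) (f := fun y => greatCircleDist x y) hψ
    (Continuous.comp (g := fun p : UnitSphere d × UnitSphere d => greatCircleDist p.1 p.2)
      (f := fun y => (x, y)) continuous_greatCircleDist (Continuous.prodMk_right x))

theorem capIntegral_eq_sphericalConv (ψ : Set.Icc (0 : ℝ) Real.pi → ℝ) (x : UnitSphere d) :
    capIntegral d x ψ = sphericalConv ψ x 1 := by
  simp [capIntegral, sphericalConv, isotropicKernel]

theorem sphericalConv_sphereIsometry (ψ : Set.Icc (0 : ℝ) Real.pi → ℝ) (g)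
    (x : UnitSphere d) (f : UnitSphere d → ℝ) :
    sphericalConv ψ (sphereIsometry g x) f = sphericalConv ψ x (f ∘ sphereIsometry g) := by
  rw [sphericalConv, ← integral_comp_sphereIsometry g]
  simp [sphericalConv, greatCircleDist_sphereIsometry]

theorem capIntegral_eq_capIntegral (ψ : Set.Icc (0 : ℝ) Real.pi → ℝ) (x y : UnitSphere d) :
    capIntegral d x ψ = capIntegral d y ψ := by
  obtain ⟨g, hg, -⟩ := exists_sphereIsometry (x := x) (y := x) (x' := y) (y' := y)
    (by rw [greatCircleDist_self, greatCircleDist_self])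
  rw [capIntegral_eq_sphericalConv, capIntegral_eq_sphericalConv, ← hg,
    sphericalConv_sphereIsometry]
  rfl

/-- A positive definite isotropic kernel and its convolutions as inner products. -/
theorem exists_feature_sphericalConv {ψ : Set.Icc (0 : ℝ) Real.pi → ℝ}
    (hψ : ψ ∈ isotropicClass d) :
    ∃ (H : Type) (_ : NormedAddCommGroup H) (_ : InnerProductSpace ℝ H)
      (u : UnitSphere d → H) (v : C(UnitSphere d, ℝ) → H),
      (∀ x y, inner ℝ (u x) (u y) = ψ (greatCircleDist x y)) ∧
      (∀ x f, inner ℝ (u x) (v f) = sphericalConv ψ x f) ∧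
      ∀ f g : C(UnitSphere d, ℝ),
        inner ℝ (v f) (v g) = ∫ x, sphericalConv ψ x f * g x ∂surfaceMeasure d := by
  obtain ⟨hc, h1, hpd⟩ := hψ
  obtain ⟨H, _, _, _, u, hu⟩ := hpd.exists_feature fun x y => by
    simp only [isotropicKernel, greatCircleDist_comm x y]
  simp only [isotropicKernel] at hu
  -- Continuity of `ψ` at `0` suffices, because `‖u y - u x‖² = 2 - 2ψ(θ(x, y))`. It makes the
  -- vector integral `∫ f(y) u(y) dy`, which serves as `v f`, meaningful.
  have hcont : Continuous u := by
    rw [continuous_iff_continuousAt]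
    intro x
    rw [ContinuousAt, tendsto_iff_norm_sub_tendsto_zero]
    have h2 : ∀ y, ‖u y - u x‖ = √(2 - 2 * ψ (greatCircleDist x y)) := fun y => by
      rw [← Real.sqrt_sq (norm_nonneg (u y - u x)), norm_sub_sq_real,
        ← real_inner_self_eq_norm_sq, ← real_inner_self_eq_norm_sq, hu, hu, hu,
        greatCircleDist_self, greatCircleDist_self, h1, greatCircleDist_comm]
      ring_nf
    simp_rw [h2]
    have h3 : Continuous fun y => √(2 - 2 * ψ (greatCircleDist x y)) :=
      (continuous_const.sub (continuous_const.mul (continuous_kernel hc x))).sqrt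
    have := h3.tendsto x
    rwa [greatCircleDist_self, h1, mul_one, sub_self, Real.sqrt_zero] at this
  have hint : ∀ f : C(UnitSphere d, ℝ), Integrable (fun y => f y • u y) (surfaceMeasure d) :=
    fun f => Continuous.integrable_surfaceMeasure (by fun_prop)
  have hv : ∀ x (f : C(UnitSphere d, ℝ)),
      inner ℝ (u x) (∫ y, f y • u y ∂surfaceMeasure d) = sphericalConv ψ x f := fun x f => by
    rw [← integral_inner (hint f)]
    simp [sphericalConv, inner_smul_right, hu, mul_comm]
  refine ⟨H, inferInstance, inferInstance, u, fun f => ∫ y, f y • u y ∂surfaceMeasure d, hu, hv,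
    fun f g => ?_⟩
  rw [← integral_inner (hint g)]
  simp_rw [inner_smul_right, real_inner_comm, hv, mul_comm]

theorem abs_le_one_of_mem_isotropicClass {ψ : Set.Icc (0 : ℝ) Real.pi → ℝ}
    (hd : 1 ≤ d) (hψ : ψ ∈ isotropicClass d) (t : Set.Icc (0 : ℝ) Real.pi) : |ψ t| ≤ 1 := by
  obtain ⟨H, _, _, u, v, hu, -⟩ := exists_feature_sphericalConv hψ
  obtain ⟨x, γ, -, h⟩ := exists_path_greatCircleDist hd
  have hn : ∀ y, ‖u y‖ = 1 := fun y => by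
    rw [← sq_eq_sq₀ (norm_nonneg _) zero_le_one, ← real_inner_self_eq_norm_sq, hu,
      greatCircleDist_self, hψ.2.1, one_pow]
  have := abs_real_inner_le_norm (u x) (u (γ t))
  rwa [hu, h, hn, hn, one_mul] at this

/-- The bound does not depend on `ψ`; boundedness and equicontinuity of the whole class rest on it.
-/
theorem abs_sphericalConv_le {ψ : Set.Icc (0 : ℝ) Real.pi → ℝ}
    (hd : 1 ≤ d) (hψ : ψ ∈ isotropicClass d) (x : UnitSphere d) {f : UnitSphere d → ℝ}
    (hf : Continuous f) : |sphericalConv ψ x f| ≤ ∫ y, |f y| ∂surfaceMeasure d := by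
  refine (abs_integral_le_integral_abs).trans (integral_mono ?_ ?_ fun y => ?_)
  · exact (((continuous_kernel hψ.1 x).mul hf).abs).integrable_surfaceMeasure
  · exact hf.abs.integrable_surfaceMeasure
  · simp only [abs_mul]
    exact mul_le_of_le_one_left (abs_nonneg _) (abs_le_one_of_mem_isotropicClass hd hψ _)

theorem sphericalConv_sub {ψ : Set.Icc (0 : ℝ) Real.pi → ℝ} (hψ : Continuous ψ)
    (x : UnitSphere d) {f g : UnitSphere d → ℝ} (hf : Continuous f) (hg : Continuous g) :
    sphericalConv ψ x (f - g) = sphericalConv ψ x f - sphericalConv ψ x g := by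
  rw [sphericalConv, sphericalConv, sphericalConv, ← integral_sub]
  · simp [mul_sub]
  · exact ((continuous_kernel hψ x).mul hf).integrable_surfaceMeasure
  · exact ((continuous_kernel hψ x).mul hg).integrable_surfaceMeasure

theorem sphericalConv_add {ψ : Set.Icc (0 : ℝ) Real.pi → ℝ} (hψ : Continuous ψ)
    (x : UnitSphere d) {f g : UnitSphere d → ℝ} (hf : Continuous f) (hg : Continuous g) :
    sphericalConv ψ x (f + g) = sphericalConv ψ x f + sphericalConv ψ x g := by
  rw [sphericalConv, sphericalConv, sphericalConv, ← integral_add]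
  · simp [mul_add]
  · exact ((continuous_kernel hψ x).mul hf).integrable_surfaceMeasure
  · exact ((continuous_kernel hψ x).mul hg).integrable_surfaceMeasure

theorem sphericalConv_smul (ψ : Set.Icc (0 : ℝ) Real.pi → ℝ) (x : UnitSphere d) (a : ℝ)
    (f : UnitSphere d → ℝ) : sphericalConv ψ x (a • f) = a * sphericalConv ψ x f := by
  rw [sphericalConv, sphericalConv, ← integral_const_mul]
  simp [mul_left_comm]

/-- The convolutions of `f` with all members of `Ψᵈ` form an equicontinuous family. -/
theorem equicontinuous_sphericalConv {ι : Type*} (hd : 1 ≤ d)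
    {ψ : ι → Set.Icc (0 : ℝ) Real.pi → ℝ} (hψ : ∀ k, ψ k ∈ isotropicClass d)
    (f : C(UnitSphere d, ℝ)) : Equicontinuous fun k x => sphericalConv (ψ k) x f := by
  intro x
  obtain ⟨G, hG, hGt⟩ := exists_sphereIsometry_tendsto x
  -- Moving `x` to `z = G z x` amounts to replacing `f` by `f ∘ G z`. The change in the convolution
  -- is therefore at most the `L¹` distance of these two functions, uniformly in `ψ`.
  have hlim : Filter.Tendsto
      (fun z => ∫ y, |f (sphereIsometry (G z) y) - f y| ∂surfaceMeasure d) (nhds x) (nhds 0) := by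
    have h0 : (0 : ℝ) = ∫ _ : UnitSphere d, (0 : ℝ) ∂surfaceMeasure d := by simp
    rw [h0]
    refine tendsto_integral_filter_of_dominated_convergence (fun _ => 2 * ‖f‖) ?_ ?_ ?_ ?_
    · exact .of_forall fun z => Continuous.aestronglyMeasurable (by fun_prop)
    · refine .of_forall fun z => .of_forall fun y => ?_
      rw [Real.norm_eq_abs, abs_abs]
      have h1 := f.norm_coe_le_norm (sphereIsometry (G z) y)
      have h2 := f.norm_coe_le_norm y
      rw [Real.norm_eq_abs] at h1 h2
      have := abs_sub (f (sphereIsometry (G z) y)) (f y)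
      linarith
    · exact integrable_const _
    · refine .of_forall fun y => ?_
      have := ((f.continuous.tendsto y).comp (hGt y)).sub_const (f y)
      simpa using this.abs
  rw [Metric.equicontinuousAt_iff_right]
  intro ε hε
  filter_upwards [hG, hlim.eventually_lt_const hε] with z hz hlt k
  rw [dist_comm, Real.dist_eq]
  refine lt_of_le_of_lt ?_ hlt
  nth_rewrite 1 [← hz]
  rw [sphericalConv_sphereIsometry, ← sphericalConv_sub (hψ k).1 _ (by fun_prop) (by fun_prop)]
  exact abs_sphericalConv_le hd (hψ k) x (by fun_prop)

end

/-! ### Weak limits of isotropic positive definite functions. -/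

section
variable {d : ℕ}

theorem exists_tendsto_of_abs_le (U : Ultrafilter ℕ) (a : ℕ → ℝ) (C : ℝ) (h : ∀ k, |a k| ≤ C) :
    ∃ l, Filter.Tendsto a U (nhds l) := by
  obtain ⟨l, -, hl⟩ := (isCompact_closedBall (0 : ℝ) C).ultrafilter_le_nhds (U.map a)
    (Filter.le_principal_iff.2 (Filter.mem_map.2 (Filter.univ_mem' fun k => by
      simpa [Real.dist_eq] using h k)))
  exact ⟨l, hl⟩

theorem tendsto_integral_mul_of_tendstoUniformly {U : Filter ℕ} {F : ℕ → UnitSphere d → ℝ}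
    {G : UnitSphere d → ℝ} (hF : ∀ k, Continuous (F k)) (hG : Continuous G)
    (h : TendstoUniformly F G U) (g : C(UnitSphere d, ℝ)) :
    Filter.Tendsto (fun k => ∫ x, F k x * g x ∂surfaceMeasure d) U
      (nhds (∫ x, G x * g x ∂surfaceMeasure d)) := by
  set M := ∫ x, |g x| ∂surfaceMeasure d
  have hM : 0 ≤ M := integral_nonneg fun x => abs_nonneg _
  rw [Metric.tendsto_nhds]
  intro ε hε
  filter_upwards [Metric.tendstoUniformly_iff.1 h (ε / (M + 1)) (by positivity)] with k hk
  have h1 : Integrable (fun x => F k x * g x) (surfaceMeasure d) :=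
    ((hF k).mul g.continuous).integrable_surfaceMeasure
  have h2 : Integrable (fun x => G x * g x) (surfaceMeasure d) :=
    (hG.mul g.continuous).integrable_surfaceMeasure
  rw [Real.dist_eq, ← integral_sub h1 h2]
  have hle : |∫ x, (F k x * g x - G x * g x) ∂surfaceMeasure d| ≤ ε / (M + 1) * M := by
    rw [← integral_const_mul]
    refine abs_integral_le_integral_abs.trans (integral_mono ?_ ?_ fun x => ?_)
    · exact (h1.sub h2).abs
    · exact (continuous_const.mul g.continuous.abs).integrable_surfaceMeasure
    · have := (hk x).le
      rw [dist_comm, Real.dist_eq] at this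
      simp only [← sub_mul, abs_mul]
      gcongr
  refine hle.trans_lt ?_
  rw [div_mul_eq_mul_div, div_lt_iff₀ (by positivity)]
  nlinarith

/-- A family of functionals `L x` on `C(𝕊ᵈ)`, invariant under isometries, which induces a positive
semidefinite form dominating each `L x`, is the convolution with a continuous positive definite
isotropic function. -/
theorem exists_isotropic_of_functional (hd : 1 ≤ d)
    (L : UnitSphere d → C(UnitSphere d, ℝ) →ₗ[ℝ] ℝ) (hcont : ∀ f, Continuous fun x => L x f)
    (hrot : ∀ g x f, L (sphereIsometry g x) f = L x (f.comp (sphereIsometry g : C(UnitSphere d, UnitSphere d))))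
    (hsymm : ∀ f g : C(UnitSphere d, ℝ),
      ∫ x, L x f * g x ∂surfaceMeasure d = ∫ x, L x g * f x ∂surfaceMeasure d)
    (hpos : ∀ f : C(UnitSphere d, ℝ), 0 ≤ ∫ x, L x f * f x ∂surfaceMeasure d)
    (hle : ∀ x (f : C(UnitSphere d, ℝ)), L x f ^ 2 ≤ ∫ x, L x f * f x ∂surfaceMeasure d) :
    ∃ φ : Set.Icc (0 : ℝ) Real.pi → ℝ, Continuous φ ∧
      IsPositiveDefiniteKernel (fun x y : UnitSphere d => (isotropicKernel d φ x y : ℂ)) ∧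
      φ ⟨0, le_rfl, Real.pi_pos.le⟩ ≤ 1 ∧
      ∀ x (f : C(UnitSphere d, ℝ)), sphericalConv φ x f = L x f := by
  have hi : ∀ f g : C(UnitSphere d, ℝ), Integrable (fun x => L x f * g x) (surfaceMeasure d) :=
    fun f g => ((hcont f).mul g.continuous).integrable_surfaceMeasure
  let B : C(UnitSphere d, ℝ) →ₗ[ℝ] C(UnitSphere d, ℝ) →ₗ[ℝ] ℝ :=
    LinearMap.mk₂ ℝ (fun f g => ∫ x, L x f * g x ∂surfaceMeasure d)
      (fun f₁ f₂ g => by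
        rw [← integral_add (hi _ _) (hi _ _)]; simp [add_mul])
      (fun a f g => by
        rw [smul_eq_mul, ← integral_const_mul]; simp [mul_assoc])
      (fun f g₁ g₂ => by
        rw [← integral_add (hi _ _) (hi _ _)]; simp [mul_add])
      (fun a f g => by
        rw [smul_eq_mul, ← integral_const_mul]; simp [mul_left_comm])
  have hB : ∀ f g, B f g = ∫ x, L x f * g x ∂surfaceMeasure d := fun f g => rfl
  obtain ⟨H, _, _, _, ι, hι, hdense⟩ := exists_hilbert_of_posSemidef B hsymm hpos
  choose w hw1 hw using fun x => exists_inner_eq_of_sq_le ι hdense (L x) fun f => by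
    rw [hι]; exact hle x f
  have hwc : ∀ v, Continuous fun x => inner ℝ (w x) v :=
    continuous_inner_of_denseRange ι hdense w hw1 fun f => by simpa only [hw] using hcont f
  have hBrot : ∀ (g : EuclideanSpace ℝ (Fin (d + 1)) ≃ₗᵢ[ℝ] EuclideanSpace ℝ (Fin (d + 1)))
      (f : C(UnitSphere d, ℝ)), B (f.comp (sphereIsometry g : C(UnitSphere d, UnitSphere d))) (f.comp (sphereIsometry g : C(UnitSphere d, UnitSphere d)))
      = B f f := fun g f => by
    rw [hB, hB]
    simp_rw [← hrot]
    exact integral_comp_sphereIsometry g fun x => L x f * f x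
  have hιrot : ∀ (g : EuclideanSpace ℝ (Fin (d + 1)) ≃ₗᵢ[ℝ] EuclideanSpace ℝ (Fin (d + 1)))
      (f : C(UnitSphere d, ℝ)), ‖ι (f.comp (sphereIsometry g : C(UnitSphere d, UnitSphere d)))‖ = ‖ι f‖ := fun g f => by
    rw [← sq_eq_sq₀ (norm_nonneg _) (norm_nonneg _), ← real_inner_self_eq_norm_sq,
      ← real_inner_self_eq_norm_sq, hι, hι, hBrot]
  -- No unitary action on `H` is constructed: norms are compared by duality, and `s = ±1` recovers
  -- the inner product by polarisation.
  have hnorm : ∀ g x y (s : ℝ),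
      ‖w (sphereIsometry g x) + s • w (sphereIsometry g y)‖ = ‖w x + s • w y‖ := by
    intro g x y s
    apply le_antisymm
    · refine norm_le_of_inner_match ι hdense _ _ fun f => ⟨f.comp (sphereIsometry g : C(UnitSphere d, UnitSphere d)), ?_,
        hιrot g f⟩
      simp only [inner_add_left, real_inner_smul_left, hw, hrot]
    · refine norm_le_of_inner_match ι hdense _ _ fun f =>
        ⟨f.comp ((sphereIsometry g).symm : C(UnitSphere d, UnitSphere d)), ?_, ?_⟩
      · simp only [inner_add_left, real_inner_smul_left, hw, hrot]
        congr <;> ext z <;> simp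
      · rw [← hιrot g]
        congr 2
        ext z
        simp
  have hinner : ∀ x y, inner ℝ (w x) (w y)
      = (‖w x + (1 : ℝ) • w y‖ ^ 2 - ‖w x + (-1 : ℝ) • w y‖ ^ 2) / 4 := fun x y => by
    rw [norm_add_sq_real, norm_add_sq_real, inner_smul_right, inner_smul_right, norm_smul,
      norm_smul]
    simp
    ring
  obtain ⟨φ, hφ, hφw⟩ := exists_isotropic_of_invariant hd (fun x y => inner ℝ (w x) (w y))
    (fun g x y => by rw [hinner, hinner, hnorm, hnorm])
    (fun x => by simpa only [real_inner_comm] using hwc (w x))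
  -- `ι f` is the weak integral of `f(y) w(y)`. Both sides are continuous in `v`, and on `v = ι g`
  -- they agree by the definition of `B`. The choice `v = w x` then identifies convolution with `φ`
  -- as `L x`.
  have hkey : ∀ (f : C(UnitSphere d, ℝ)) (v : H),
      ∫ y, inner ℝ (w y) v * f y ∂surfaceMeasure d = inner ℝ v (ι f) := by
    intro f v
    have hiv : ∀ v, Integrable (fun y => inner ℝ (w y) v * f y) (surfaceMeasure d) := fun v =>
      ((hwc v).mul f.continuous).integrable_surfaceMeasure
    refine hdense.induction_on v (isClosed_eq ?_ (by fun_prop)) fun g => ?_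
    · let T : H →ₗ[ℝ] ℝ :=
        { toFun := fun v => ∫ y, inner ℝ (w y) v * f y ∂surfaceMeasure d
          map_add' := fun v v' => by
            rw [← integral_add (hiv v) (hiv v')]
            simp_rw [inner_add_right, add_mul]
          map_smul' := fun a v => by
            rw [RingHom.id_apply, smul_eq_mul, ← integral_const_mul]
            simp_rw [real_inner_smul_right, mul_assoc] }
      refine AddMonoidHomClass.continuous_of_bound T (∫ y, |f y| ∂surfaceMeasure d) fun v => ?_
      rw [← integral_mul_const, Real.norm_eq_abs]
      refine abs_integral_le_integral_abs.trans (integral_mono (hiv v).abs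
        (f.continuous.abs.mul continuous_const).integrable_surfaceMeasure fun y => ?_)
      simp only [abs_mul]
      rw [mul_comm]
      gcongr
      refine (abs_real_inner_le_norm _ _).trans ?_
      exact mul_le_of_le_one_left (norm_nonneg _) (hw1 y)
    · rw [hι, hB]
      simp_rw [hw]
  refine ⟨φ, hφ, ?_, ?_, fun x f => ?_⟩
  · simp only [isotropicKernel, hφw]
    exact isPositiveDefiniteKernel_inner w
  · have x := northPole d
    rw [← greatCircleDist_self x, hφw, real_inner_self_eq_norm_sq]
    exact pow_le_one₀ (norm_nonneg _) (hw1 x)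
  · simp only [sphericalConv, hφw]
    rw [← hw, ← hkey]
    simp_rw [real_inner_comm]

/-- Weak sequential compactness of `Ψᵈ`, up to a loss of mass at the origin. -/
theorem exists_weak_limit (hd : 1 ≤ d) {ψ : ℕ → Set.Icc (0 : ℝ) Real.pi → ℝ}
    (hψ : ∀ k, ψ k ∈ isotropicClass d) :
    ∃ U : Ultrafilter ℕ, (U : Filter ℕ) ≤ Filter.atTop ∧
      ∃ φ : Set.Icc (0 : ℝ) Real.pi → ℝ, Continuous φ ∧
        IsPositiveDefiniteKernel (fun x y : UnitSphere d => (isotropicKernel d φ x y : ℂ)) ∧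
        φ ⟨0, le_rfl, Real.pi_pos.le⟩ ≤ 1 ∧
        ∀ x (f : C(UnitSphere d, ℝ)),
          Filter.Tendsto (fun k => sphericalConv (ψ k) x f) U (nhds (sphericalConv φ x f)) := by
  -- Along an ultrafilter all the bounded sequences, for every `x` and `f`, converge at once,
  -- without extracting subsequences.
  let U : Ultrafilter ℕ := Filter.hyperfilter ℕ
  have hU : (U : Filter ℕ) ≤ Filter.atTop := by
    simpa [Nat.cofinite_eq_atTop] using Filter.hyperfilter_le_cofinite (α := ℕ)
  choose l hl using fun x (f : C(UnitSphere d, ℝ)) => exists_tendsto_of_abs_le U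
    (fun k => sphericalConv (ψ k) x f) _ fun k => abs_sphericalConv_le hd (hψ k) x f.continuous
  have hequi := fun f => equicontinuous_sphericalConv hd hψ f
  have hck : ∀ f : C(UnitSphere d, ℝ), ∀ k, Continuous fun x => sphericalConv (ψ k) x f :=
    fun f k => (hequi f).continuous k
  -- On the compact sphere equicontinuity upgrades pointwise convergence to uniform convergence, as
  -- needed to pass to the limit in the quadratic forms.
  have hunif : ∀ f : C(UnitSphere d, ℝ),
      TendstoUniformly (fun k x => sphericalConv (ψ k) x f) (fun x => l x f) U := fun f =>
    UniformFun.tendsto_iff_tendstoUniformly.1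
      (((hequi f).tendsto_uniformFun_iff_pi U fun x => l x f).2
        (tendsto_pi_nhds.2 fun x => hl x f))
  have hlc : ∀ f, Continuous fun x => l x f := fun f =>
    (hunif f).continuous (Filter.Frequently.of_forall (hck f))
  let L : UnitSphere d → C(UnitSphere d, ℝ) →ₗ[ℝ] ℝ := fun x =>
    { toFun := l x
      map_add' := fun f g => tendsto_nhds_unique (hl x (f + g)) (by
        simpa [sphericalConv_add (hψ _).1 x f.continuous g.continuous] using
          (hl x f).add (hl x g))
      map_smul' := fun a f => tendsto_nhds_unique (hl x (a • f)) (by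
        simpa [sphericalConv_smul] using (hl x f).const_mul a) }
  have hLl : ∀ x f, L x f = l x f := fun x f => rfl
  have hB : ∀ f g : C(UnitSphere d, ℝ), Filter.Tendsto
      (fun k => ∫ x, sphericalConv (ψ k) x f * g x ∂surfaceMeasure d) U
      (nhds (∫ x, L x f * g x ∂surfaceMeasure d)) := fun f g =>
    tendsto_integral_mul_of_tendstoUniformly (hck f) (hlc f) (hunif f) g
  obtain ⟨φ, h1, h2, h3, h4⟩ := exists_isotropic_of_functional hd L hlc
    (fun g x f => by
      refine tendsto_nhds_unique (hl _ f) ?_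
      simp_rw [sphericalConv_sphereIsometry]
      exact hl x (f.comp (sphereIsometry g : C(UnitSphere d, UnitSphere d))))
    (fun f g => by
      refine tendsto_nhds_unique (hB f g) ((hB g f).congr fun k => ?_)
      obtain ⟨H, _, _, u, v, -, -, hv⟩ := exists_feature_sphericalConv (hψ k)
      rw [← hv, ← hv, real_inner_comm])
    (fun f => ge_of_tendsto' (hB f f) fun k => by
      obtain ⟨H, _, _, u, v, -, -, hv⟩ := exists_feature_sphericalConv (hψ k)
      rw [← hv]
      exact real_inner_self_nonneg)
    (fun x f => le_of_tendsto_of_tendsto' ((hl x f).pow 2) (hB f f) fun k => by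
      obtain ⟨H, _, _, u, v, hu, huv, hv⟩ := exists_feature_sphericalConv (hψ k)
      have h := real_inner_mul_inner_self_le (u x) (v f)
      rwa [hu, greatCircleDist_self, (hψ k).2.1, one_mul, huv, hv, ← pow_two] at h)
  exact ⟨U, hU, φ, h1, h2, h3, fun x f => by rw [h4]; exact hl x f⟩

end

/-! ### Existence of an extremal function for `c < π`. -/

section
variable {d : ℕ}

theorem integral_pos_of_continuous_nonneg {f : UnitSphere d → ℝ} (hf : Continuous f)
    (h0 : ∀ y, 0 ≤ f y) {x : UnitSphere d} (hx : f x ≠ 0) : 0 < ∫ y, f y ∂surfaceMeasure d :=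
  hf.integral_pos_of_hasCompactSupport_nonneg_nonzero (HasCompactSupport.of_compactSpace f) h0
    fun h => hx (h ▸ rfl)

theorem div_mem_capClass {c : ℝ} {φ : Set.Icc (0 : ℝ) Real.pi → ℝ} (hφ : Continuous φ)
    (hpd : IsPositiveDefiniteKernel (fun x y : UnitSphere d => (isotropicKernel d φ x y : ℂ)))
    {s : ℝ} (hs : φ ⟨0, le_rfl, Real.pi_pos.le⟩ = s) (hpos : 0 < s)
    (hc : ∀ t : Set.Icc (0 : ℝ) Real.pi, c ≤ (t : ℝ) → φ t = 0) :
    (fun t => φ t / s) ∈ capClass d c := by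
  refine ⟨⟨hφ.div_const s, ?_, ?_⟩, fun t ht => ?_⟩
  · simp only [hs]
    exact div_self hpos.ne'
  · refine isPositiveDefiniteKernel_of_real _ (fun x y => by
      simp only [isotropicKernel, greatCircleDist_comm x y]) fun n x a => ?_
    have := mul_nonneg (hpd.real_nonneg n x a) (inv_nonneg.2 hpos.le)
    simp only [isotropicKernel, Finset.sum_mul, div_eq_mul_inv] at this ⊢
    simpa only [mul_assoc] using this
  · simp only [hc t ht, zero_div]

theorem capIntegral_div (φ : Set.Icc (0 : ℝ) Real.pi → ℝ) (s : ℝ) (x : UnitSphere d) :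
    capIntegral d x (fun t => φ t / s) = capIntegral d x φ / s := by
  simp only [capIntegral, isotropicKernel]
  exact integral_div _ _

/-- The autocorrelation of a tent supported on a cap of radius `c / 2`: its quadratic forms are
integrals of squares, and by the triangle inequality the two caps do not overlap once their centres
are at distance at least `c`. -/
theorem exists_mem_capClass_capIntegral_pos (hd : 1 ≤ d) {c : ℝ} (hc : 0 < c) (x : UnitSphere d) :
    ∃ ψ ∈ capClass d c, 0 < capIntegral d x ψ := by
  let χ : Set.Icc (0 : ℝ) Real.pi → ℝ := fun t => max 0 (c / 2 - t)
  have hχ : Continuous χ := by fun_prop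
  have hχ0 : ∀ t, 0 ≤ χ t := fun t => le_max_left _ _
  have hχ1 : ∀ t, χ t ≤ c / 2 := fun t => max_le (by positivity) (by linarith [t.2.1])
  have hc2 : ∀ a b : UnitSphere d, Continuous fun z => χ (greatCircleDist a z) * χ (greatCircleDist b z) :=
    fun a b => (continuous_kernel hχ a).mul (continuous_kernel hχ b)
  let F : UnitSphere d → UnitSphere d → ℝ := fun a b =>
    ∫ z, χ (greatCircleDist a z) * χ (greatCircleDist b z) ∂surfaceMeasure d
  have hF0 : ∀ a b, 0 ≤ F a b := fun a b => integral_nonneg fun z => mul_nonneg (hχ0 _) (hχ0 _)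
  have hFc : ∀ a, Continuous (F a) := fun a => by
    refine continuous_of_dominated (bound := fun _ => c / 2 * (c / 2))
      (fun b => (hc2 a b).aestronglyMeasurable) (fun b => .of_forall fun z => ?_)
      (integrable_const _) (.of_forall fun z => ?_)
    · rw [Real.norm_eq_abs, abs_of_nonneg (mul_nonneg (hχ0 _) (hχ0 _))]
      exact mul_le_mul (hχ1 _) (hχ1 _) (hχ0 _) (by positivity)
    · simp_rw [greatCircleDist_comm _ z]
      exact continuous_const.mul (continuous_kernel hχ z)
  have hFpos : 0 < F x x := by
    refine integral_pos_of_continuous_nonneg (hc2 x x) (fun z => mul_nonneg (hχ0 _) (hχ0 _))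
      (x := x) ?_
    have : χ (greatCircleDist x x) = c / 2 := by
      rw [greatCircleDist_self]
      simp only [χ, sub_zero]
      exact max_eq_right (by positivity)
    rw [this]
    positivity
  obtain ⟨φ, hφ, hφF⟩ := exists_isotropic_of_invariant hd F (fun g a b => by
    simp only [F]
    rw [← integral_comp_sphereIsometry g]
    simp only [greatCircleDist_sphereIsometry]) hFc
  refine ⟨_, div_mem_capClass (c := c) hφ ?_ (by rw [← greatCircleDist_self x, hφF]) hFpos
    fun t ht => ?_, ?_⟩
  · simp only [isotropicKernel, hφF]
    refine isPositiveDefiniteKernel_of_real _ (fun a b => by simp only [F, mul_comm])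
      fun n y a => ?_
    have hint : ∀ i j, Integrable (fun z => a i * χ (greatCircleDist (y i) z)
        * (a j * χ (greatCircleDist (y j) z))) (surfaceMeasure d) := fun i j =>
      ((continuous_const.mul (continuous_kernel hχ _)).mul
        (continuous_const.mul (continuous_kernel hχ _))).integrable_surfaceMeasure
    have h : ∑ i, ∑ j, a i * a j * F (y i) (y j)
        = ∫ z, (∑ i, a i * χ (greatCircleDist (y i) z)) ^ 2 ∂surfaceMeasure d := by
      simp_rw [pow_two, Finset.sum_mul_sum]
      rw [integral_finsetSum _ fun i _ => integrable_finsetSum _ fun j _ => hint i j]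
      refine Finset.sum_congr rfl fun i _ => ?_
      rw [integral_finsetSum _ fun j _ => hint i j]
      refine Finset.sum_congr rfl fun j _ => ?_
      rw [← integral_const_mul]
      exact integral_congr_ae (.of_forall fun z => by simp only; ring)
    rw [h]
    exact integral_nonneg fun z => sq_nonneg _
  · obtain ⟨x₀, γ, -, hγ⟩ := exists_path_greatCircleDist hd
    rw [← hγ t, hφF]
    refine integral_eq_zero_of_ae (.of_forall fun z => ?_)
    have h1 := greatCircleDist_triangle x₀ z (γ t)
    rw [hγ, greatCircleDist_comm z] at h1
    rcases le_total (c / 2) (greatCircleDist x₀ z) with h2 | h2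
    · have : χ (greatCircleDist x₀ z) = 0 := max_eq_left (by linarith)
      simp [this]
    · have : χ (greatCircleDist (γ t) z) = 0 := max_eq_left (by linarith)
      simp [this]
  · rw [capIntegral_div]
    refine div_pos ?_ hFpos
    simp only [capIntegral, isotropicKernel, hφF]
    exact integral_pos_of_continuous_nonneg (hFc x) (hF0 x) hFpos.ne'

theorem capIntegral_le (hd : 1 ≤ d) {ψ : Set.Icc (0 : ℝ) Real.pi → ℝ}
    (hψ : ψ ∈ isotropicClass d) (x : UnitSphere d) :
    capIntegral d x ψ ≤ ∫ _ : UnitSphere d, (1 : ℝ) ∂surfaceMeasure d := by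
  rw [capIntegral_eq_sphericalConv]
  simpa using (le_abs_self _).trans (abs_sphericalConv_le hd hψ x (f := 1) continuous_one)

theorem exists_extremal_of_lt_pi (hd : 1 ≤ d) {c : ℝ} (hc : 0 < c) (hcπ : c < Real.pi)
    (x : UnitSphere d) :
    ∃ ψ ∈ capClass d c, ∀ φ ∈ capClass d c, capIntegral d x φ ≤ capIntegral d x ψ := by
  obtain ⟨ψ₁, hψ₁, hψ₁pos⟩ := exists_mem_capClass_capIntegral_pos hd hc x
  have hbdd : BddAbove (capIntegral d x '' capClass d c) := by
    refine ⟨∫ _ : UnitSphere d, (1 : ℝ) ∂surfaceMeasure d, ?_⟩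
    rintro _ ⟨φ, hφ, rfl⟩
    exact capIntegral_le hd hφ.1 x
  obtain ⟨a, -, ha, hmem⟩ := exists_seq_tendsto_sSup
    ⟨capIntegral d x ψ₁, Set.mem_image_of_mem _ hψ₁⟩ hbdd
  set T := sSup (capIntegral d x '' capClass d c)
  have hT : ∀ φ ∈ capClass d c, capIntegral d x φ ≤ T := fun φ hφ =>
    le_csSup hbdd (Set.mem_image_of_mem _ hφ)
  have hTpos : 0 < T := hψ₁pos.trans_le (hT _ hψ₁)
  choose ψ hψ hψa using hmem
  obtain ⟨U, hU, φ, hφ, hpd, hφ1, hlim⟩ := exists_weak_limit hd fun k => (hψ k).1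
  have hφT : capIntegral d x φ = T := by
    rw [capIntegral_eq_sphericalConv]
    refine tendsto_nhds_unique (hlim x 1) ((ha.mono_left hU).congr fun k => ?_)
    rw [← hψa, capIntegral_eq_sphericalConv]
    rfl
  have hgt : ∀ t : Set.Icc (0 : ℝ) Real.pi, c < t → φ t = 0 := by
    obtain ⟨x₀, γ, -, hγ⟩ := exists_path_greatCircleDist hd
    intro t ht
    by_contra hne
    -- Testing against `(t - c)₊ φ(t)` gives zero for every `ψ k`, while in the limit the integrand
    -- becomes `(t - c)₊ φ(t)² ≥ 0`.
    have hb : Continuous fun t : Set.Icc (0 : ℝ) Real.pi => max 0 ((t : ℝ) - c) * φ t := by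
      fun_prop
    have hz : sphericalConv φ x₀ (fun y => max 0 ((greatCircleDist x₀ y : ℝ) - c)
        * φ (greatCircleDist x₀ y)) = 0 := by
      refine tendsto_nhds_unique (hlim x₀ ⟨_, continuous_kernel hb x₀⟩)
        (tendsto_const_nhds.congr fun k => ?_)
      rw [eq_comm]
      refine integral_eq_zero_of_ae (.of_forall fun y => ?_)
      rcases le_total c (greatCircleDist x₀ y) with h | h
      · simp [(hψ k).2 _ h]
      · simp [max_eq_left (sub_nonpos.2 h)]
    refine (integral_pos_of_continuous_nonneg
      ((continuous_kernel hφ x₀).mul (continuous_kernel hb x₀)) (fun y => ?_)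
      (x := γ t) ?_).ne' hz
    · change 0 ≤ φ _ * (_ * φ _)
      rw [mul_left_comm]
      exact mul_nonneg (le_max_left _ _) (mul_self_nonneg _)
    · change φ (greatCircleDist x₀ (γ t)) * (max 0 ((greatCircleDist x₀ (γ t) : ℝ) - c)
        * φ (greatCircleDist x₀ (γ t))) ≠ 0
      rw [hγ, max_eq_right (sub_nonneg.2 ht.le)]
      exact mul_ne_zero hne (mul_ne_zero (sub_pos.2 ht).ne' hne)
  -- The endpoint `t = c` follows by continuity; `c < π` is what puts `c` in the closure of `(c,
  -- π)`.
  have hge : ∀ t : Set.Icc (0 : ℝ) Real.pi, c ≤ t → φ t = 0 := by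
    have heq : Set.EqOn (φ ∘ Set.projIcc 0 Real.pi Real.pi_pos.le) 0 (Set.Ioo c Real.pi) :=
      fun s hs => hgt _ (by
        rw [Set.projIcc_of_mem Real.pi_pos.le ⟨(hc.trans hs.1).le, hs.2.le⟩]
        exact hs.1)
    have hcl := heq.closure (hφ.comp continuous_projIcc) continuous_zero
    rw [closure_Ioo hcπ.ne] at hcl
    intro t ht
    have := hcl ⟨ht, t.2.2⟩
    rwa [Function.comp_apply, Set.projIcc_val] at this
  -- If `φ(0) = 0`, all feature vectors vanish, hence so does `φ ∘ θ`, contradicting `T > 0`.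
  have hs : 0 < φ ⟨0, le_rfl, Real.pi_pos.le⟩ := by
    obtain ⟨H, _, _, _, u, hu⟩ := hpd.exists_feature fun x y => by
      simp only [isotropicKernel, greatCircleDist_comm x y]
    simp only [isotropicKernel] at hu
    have h0 : ∀ y, ‖u y‖ ^ 2 = φ ⟨0, le_rfl, Real.pi_pos.le⟩ := fun y => by
      rw [← real_inner_self_eq_norm_sq, hu, greatCircleDist_self]
    refine lt_of_le_of_ne (h0 x ▸ sq_nonneg _) fun h => hTpos.ne ?_
    rw [← hφT]
    simp only [← h, sq_eq_zero_iff, norm_eq_zero] at h0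
    simp [capIntegral, isotropicKernel, ← hu, h0]
  refine ⟨_, div_mem_capClass hφ hpd rfl hs hge, fun ψ' hψ' => (hT ψ' hψ').trans ?_⟩
  rw [capIntegral_div, hφT, le_div_iff₀ hs]
  exact mul_le_of_le_one_right hTpos.le hφ1

/-! ### The case `c = π`. -/

theorem integral_inner_surfaceMeasure (x : UnitSphere d) :
    ∫ y : UnitSphere d, inner ℝ (x : EuclideanSpace ℝ (Fin (d + 1))) y ∂surfaceMeasure d = 0 := by
  have h := integral_comp_sphereIsometry (LinearIsometryEquiv.neg ℝ)
    fun y : UnitSphere d => inner ℝ (x : EuclideanSpace ℝ (Fin (d + 1))) y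
  simp only [sphereIsometry_coe, LinearIsometryEquiv.coe_neg, inner_neg_right, integral_neg] at h
  linarith

/-- With `I` the integral of `ψ` and `M` the total mass, `v 1` has squared norm `I M` and pairs to
`I` with each `u y`. Since `ψ(π) = 0`, the vectors `u x` and `u (-x)` are orthonormal, so
Cauchy–Schwarz for their sum reads `4I² ≤ 2IM`. -/
theorem two_mul_capIntegral_le {ψ : Set.Icc (0 : ℝ) Real.pi → ℝ}
    (hψ : ψ ∈ capClass d Real.pi) (x : UnitSphere d) :
    2 * capIntegral d x ψ ≤ ∫ _ : UnitSphere d, (1 : ℝ) ∂surfaceMeasure d := by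
  obtain ⟨H, _, _, u, v, hu, huv, hv⟩ := exists_feature_sphericalConv hψ.1
  have hM : 0 ≤ ∫ _ : UnitSphere d, (1 : ℝ) ∂surfaceMeasure d :=
    integral_nonneg fun _ => zero_le_one
  set M := ∫ _ : UnitSphere d, (1 : ℝ) ∂surfaceMeasure d
  have hI : ∀ y, inner ℝ (u y) (v 1) = capIntegral d x ψ := fun y => by
    rw [huv, capIntegral_eq_capIntegral ψ x y, capIntegral_eq_sphericalConv]
    rfl
  have hvv : inner ℝ (v 1) (v 1) = capIntegral d x ψ * M := by
    rw [hv, ← integral_const_mul]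
    refine integral_congr_ae (.of_forall fun y => ?_)
    simp only [← huv, hI]
    rfl
  have hπ : ψ ⟨Real.pi, Real.pi_pos.le, le_rfl⟩ = 0 := hψ.2 _ le_rfl
  have huu : inner ℝ (u x + u (-x)) (u x + u (-x)) = 2 := by
    rw [inner_add_left, inner_add_right, inner_add_right, hu, hu, hu, hu, greatCircleDist_self,
      greatCircleDist_self, greatCircleDist_comm (-x) x, greatCircleDist_neg_self, hπ, hψ.1.2.1]
    norm_num
  have hcs := real_inner_mul_inner_self_le (u x + u (-x)) (v 1)
  rw [huu, hvv, inner_add_left, hI, hI] at hcs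
  rcases le_or_gt (capIntegral d x ψ) 0 with h | h
  · linarith
  · by_contra hlt
    nlinarith

theorem exists_extremal_pi (x : UnitSphere d) :
    ∃ ψ ∈ capClass d Real.pi, ∀ φ ∈ capClass d Real.pi, capIntegral d x φ ≤ capIntegral d x ψ := by
  -- As a kernel this is `(1 + ⟨x, y⟩) / 2`, half the sum of two Gram kernels; the linear term
  -- integrates to zero by antipodal symmetry, so the bound `M / 2` is attained.
  let ψ : Set.Icc (0 : ℝ) Real.pi → ℝ := fun t => (1 + Real.cos t) / 2
  have hψ : ∀ a b : UnitSphere d, ψ (greatCircleDist a b)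
      = (1 + inner ℝ (a : EuclideanSpace ℝ (Fin (d + 1))) b) / 2 := fun a b => by
    simp only [ψ, cos_greatCircleDist]
  refine ⟨ψ, ⟨⟨by fun_prop, by simp [ψ], ?_⟩, fun t ht => ?_⟩, fun φ hφ => ?_⟩
  · refine isPositiveDefiniteKernel_of_real _ (fun a b => by
      simp only [isotropicKernel, greatCircleDist_comm a b]) fun n y a => ?_
    have h1 := (isPositiveDefiniteKernel_inner fun _ : UnitSphere d => (1 : ℝ)).real_nonneg n y a
    have h2 := (isPositiveDefiniteKernel_inner fun z : UnitSphere d =>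
      (z : EuclideanSpace ℝ (Fin (d + 1)))).real_nonneg n y a
    have h := div_nonneg (add_nonneg h1 h2) zero_le_two
    rw [← Finset.sum_add_distrib, Finset.sum_div] at h
    refine h.trans_eq (Finset.sum_congr rfl fun i _ => ?_)
    rw [← Finset.sum_add_distrib, Finset.sum_div]
    refine Finset.sum_congr rfl fun j _ => ?_
    rw [isotropicKernel, hψ]
    simp
    ring
  · have : (t : ℝ) = Real.pi := le_antisymm t.2.2 ht
    simp [ψ, this]
  · have h := two_mul_capIntegral_le hφ x
    have h2 : capIntegral d x ψ = (∫ _ : UnitSphere d, (1 : ℝ) ∂surfaceMeasure d) / 2 := by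
      simp only [capIntegral, isotropicKernel, hψ]
      rw [integral_div, integral_add (integrable_const _), integral_inner_surfaceMeasure, add_zero]
      exact Continuous.integrable_surfaceMeasure (by fun_prop)
    linarith

end

/-- Since `sSup` on `ℝ` takes the default value `0` on empty or unbounded sets, the `IsLUB` clause
certifies that the constant is a genuine supremum, the same at every base point. -/
theorem mainTheorem9 (d : ℕ) (hd : 2 ≤ d) (c : ℝ) (hc : 0 < c) (hcπ : c ≤ Real.pi) :
    ∃ ψ ∈ capClass d c, ∀ x : UnitSphere d,
      IsLUB (capIntegral d x '' capClass d c) (sphericalTuranConstant d c) ∧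
        capIntegral d x ψ = sphericalTuranConstant d c := by
  have hd1 : 1 ≤ d := by omega
  obtain ⟨ψ, hψ, hmax⟩ : ∃ ψ ∈ capClass d c, ∀ φ ∈ capClass d c,
      capIntegral d (northPole d) φ ≤ capIntegral d (northPole d) ψ := by
    rcases hcπ.lt_or_eq with h | rfl
    · exact exists_extremal_of_lt_pi hd1 hc h _
    · exact exists_extremal_pi _
  have hgreatest : IsGreatest (capIntegral d (northPole d) '' capClass d c)
      (capIntegral d (northPole d) ψ) := by
    refine ⟨Set.mem_image_of_mem _ hψ, ?_⟩
    rintro _ ⟨φ, hφ, rfl⟩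
    exact hmax φ hφ
  have hT : sphericalTuranConstant d c = capIntegral d (northPole d) ψ := hgreatest.csSup_eq
  refine ⟨ψ, hψ, fun x => ?_⟩
  have hx : capIntegral d x = capIntegral d (northPole d) :=
    funext fun φ => capIntegral_eq_capIntegral φ _ _
  rw [hx, hT]
  exact ⟨hgreatest.isLUB, rfl⟩
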